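/- Fix natural numbers $m,n$ and a nonprincipal ultrafilter $\mathcal U$ on $\mathbb N$. A $\Delta$-field is a field of characteristic zero with $m$ commuting derivations $\Delta=\{\delta_1,\dots,\delta_m\}$. For a $\Delta$-field $k$, let $k\{X\}$ be the $\Delta$-ring of $\Delta$-polynomials in $X=(X_1,\dots,X_n)$ over $k$, that is, the polynomial ring over $k$ in the indeterminates $\delta_1^{e_1}\cdots\delta_m^{e_m}X_i$ ($e_1,\dots,e_m\ge 0$, $1\le i\le n$). The degree of $f\in k\{X\}$ is its total degree in these indeterminates, and its order is the largest $e_1+\cdots+e_m$ among the indeterminates occurring in $f$ (and $0$ if there are none). For $S\subseteq k\{X\}$ let $\{S\}$ be the radical $\Delta$-ideal generated by $S$. Prime ideals are by definition proper. Given $\Delta$-fields $(K_r)_{r\in\mathbb N}$, let $K=\prod_{\mathcal U}K_r$ (an internal $\Delta$-field) and $K\{X\}_{\mathrm{int}}=\prod_{\mathcal U}(K_r\{X\})$. View $K\{X\}$ as a subring of $K\{X\}_{\mathrm{int}}$ through the embedding that sends $\sum_i a_iM_i$ (with $a_i\in K$ and $M_i$ monomials in the indeterminates $\delta_1^{e_1}\cdots\delta_m^{e_m}X_j$)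 to the class of $\big(\sum_i a_i(r)M_i\big)_r$. A subset $S\subseteq K\{X\}_{\mathrm{int}}$ is internal if there are sets $S_r\subseteq K_r\{X\}$ such that $a\in S$ if and only if $a(r)\in S_r$ for $\mathcal U$-almost all $r$; in that case $\{S\}_{\mathrm{int}}$ denotes the internal ideal of $K\{X\}_{\mathrm{int}}$ with components $\{S_r\}$, i.e. $a\in\{S\}_{\mathrm{int}}$ if and only if $a(r)\in\{S_r\}$ for $\mathcal U$-almost all $r$. **Proposition.** The following two statements are equivalent. (Definability of primality.) For every $d\in\mathbb N$ there exists $r\in\mathbb N$ (depending only on $d,n,m$) such that for every $\Delta$-field $k$ and every finite set $S\subset k\{X\}$ of $\Delta$-polynomials of degree and order $\le d$, the following are equivalent: (i) $\{S\}$ is prime; (ii) $\{S\}$ is proper, and for all $f,g\in k\{X\}$ of degree and order $\le r$, if $fg\in\{S\}$ then $f\in\{S\}$ or $g\in\{S\}$. (A) For every internal $\Delta$-field $K$ and every internal set $S\subseteq K\{X\}_{\mathrm{int}}$ that is contained in $K\{X\}$, if $\{S\}_{\mathrm{int}}\cap K\{X\}$ is prime in $K\{X\}$, then $\{S\}_{\mathrm{int}}$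 is prime in $K\{X\}_{\mathrm{int}}$. -/

import Mathlib

/-! ### Rings with commuting derivations and their differential ideals -/

/-- Derivations (additive maps satisfying the Leibniz rule) from a commutative ring to itself. -/
abbrev RingDerivation (R : Type*) [CommRing R] : Type _ := Derivation ℤ R R

/-- A commutative ring equipped with `m` commuting derivations `δ₁, …, δₘ`.
A `Δ`-field is a field together with such a structure. -/
class DeltaRing (m : ℕ) (R : Type*) [CommRing R] where
  /-- the derivations -/
  der : Fin m → RingDerivation R
  /-- the derivations commute -/
  der_comm : ∀ (i j : Fin m) (x : R), der i (der j x) = der j (der i x)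

/-- `I` is a `Δ`-ideal: it is closed under all the derivations. -/
def IsDeltaIdeal (m : ℕ) {R : Type*} [CommRing R] [DeltaRing m R] (I : Ideal R) : Prop :=
  ∀ j : Fin m, ∀ x ∈ I, DeltaRing.der j x ∈ I

/-- `{S}`: the radical `Δ`-ideal generated by `S`, i.e. the smallest radical `Δ`-ideal
containing `S`. -/
def radicalDeltaIdeal (m : ℕ) {R : Type*} [CommRing R] [DeltaRing m R] (S : Set R) : Ideal R :=
  sInf {I : Ideal R | S ⊆ I ∧ I.IsRadical ∧ IsDeltaIdeal m I}

/-! ### The ring of differential polynomials -/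

/-- The ring `k{X}` of `Δ`-polynomials over `k` in the differential indeterminates
`X = (X₁, …, Xₙ)`, for `m` derivations: the polynomial ring in the algebraic indeterminates
`δ₁ ^ e₁ ⋯ δₘ ^ eₘ Xᵢ`, the latter being indexed by the pair `(i, e)`. -/
abbrev DeltaPoly (m n : ℕ) (k : Type*) [CommRing k] : Type _ :=
  MvPolynomial (Fin n × (Fin m → ℕ)) k

namespace DeltaPoly

open MvPolynomial

/-- Apply a derivation of `k` to all coefficients of a polynomial over `k`. -/
noncomputable def coeffDer {σ k : Type*} [CommRing k] (D : RingDerivation k)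
    (p : MvPolynomial σ k) : MvPolynomial σ k :=
  ∑ e ∈ p.support, monomial e (D (coeff e p))

theorem coeff_coeffDer {σ k : Type*} [CommRing k] (D : RingDerivation k)
    (p : MvPolynomial σ k) (e : σ →₀ ℕ) : coeff e (coeffDer D p) = D (coeff e p) := by
  classical
  simp only [coeffDer, coeff_sum, coeff_monomial, Finset.sum_ite_eq', mem_support_iff]
  split_ifs with h
  · rfl
  · rw [not_not.1 h, map_zero]

/-- `coeffDer` as a derivation of the polynomial ring. -/
noncomputable def coeffDerivation {σ k : Type*} [CommRing k] (D : RingDerivation k) :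
    RingDerivation (MvPolynomial σ k) :=
  Derivation.mk'
    (AddMonoidHom.toIntLinearMap
      { toFun := coeffDer D
        map_zero' := by ext e; simp [coeff_coeffDer]
        map_add' := fun p q => by ext e; simp [coeff_coeffDer] })
    (fun p q => by
      classical
      ext e
      change coeff e (coeffDer D (p * q)) = coeff e (p • coeffDer D q + q • coeffDer D p)
      rw [coeff_coeffDer, smul_eq_mul, smul_eq_mul, mul_comm q, coeff_add, coeff_mul, coeff_mul,
        coeff_mul, map_sum, ← Finset.sum_add_distrib]
      refine Finset.sum_congr rfl fun x _ => ?_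
      rw [coeff_coeffDer, coeff_coeffDer, Derivation.leibniz, smul_eq_mul, smul_eq_mul]
      ring)

/-- The derivation `δⱼ` of `k{X}`: it extends `δⱼ` on `k` and maps `θ Xᵢ` to `δⱼ θ Xᵢ`. -/
noncomputable def deriv {m n : ℕ} {k : Type*} [CommRing k] [DeltaRing m k] (j : Fin m) :
    RingDerivation (DeltaPoly m n k) :=
  coeffDerivation (DeltaRing.der j) +
    (mkDerivation k (fun v : Fin n × (Fin m → ℕ) =>
      (X (v.1, v.2 + Pi.single j 1) : DeltaPoly m n k))).restrictScalars ℤ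

theorem deriv_C {m n : ℕ} {k : Type*} [CommRing k] [DeltaRing m k] (j : Fin m) (a : k) :
    deriv j (C a : DeltaPoly m n k) = C (DeltaRing.der j a) := by
  classical
  have h : coeffDer (DeltaRing.der j) (C a : DeltaPoly m n k) = C (DeltaRing.der j a) := by
    ext e
    rw [coeff_coeffDer, coeff_C, coeff_C]
    split_ifs <;> simp
  have h2 : mkDerivation k (fun v : Fin n × (Fin m → ℕ) =>
      (X (v.1, v.2 + Pi.single j 1) : DeltaPoly m n k)) (C a) = 0 := derivation_C _ a
  change coeffDer (DeltaRing.der j) (C a : DeltaPoly m n k) + mkDerivation k _ (C a) = _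
  rw [h, h2, add_zero]

theorem deriv_X {m n : ℕ} {k : Type*} [CommRing k] [DeltaRing m k] (j : Fin m)
    (v : Fin n × (Fin m → ℕ)) :
    deriv j (X v : DeltaPoly m n k) = X (v.1, v.2 + Pi.single j 1) := by
  classical
  have h : coeffDer (DeltaRing.der j) (X v : DeltaPoly m n k) = 0 := by
    ext e
    rw [coeff_coeffDer, coeff_X, coeff_zero]
    split_ifs <;> simp
  change coeffDer (DeltaRing.der j) (X v : DeltaPoly m n k) + mkDerivation k _ (X v) = _
  rw [h, mkDerivation_X, zero_add]

/-- `k{X}` is a `Δ`-ring. -/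
noncomputable instance instDeltaRing {m n : ℕ} {k : Type*} [CommRing k] [DeltaRing m k] :
    DeltaRing m (DeltaPoly m n k) where
  der := deriv
  der_comm i j p := by
    induction p using MvPolynomial.induction_on with
    | C a => rw [deriv_C, deriv_C, deriv_C, deriv_C, DeltaRing.der_comm]
    | add p q hp hq => simp only [map_add, hp, hq]
    | mul_X p v hp =>
      simp only [Derivation.leibniz, map_add, smul_eq_mul, deriv_X, hp, add_assoc,
        add_comm (Pi.single i 1 : Fin m → ℕ)]
      ring

/-- The order of a `Δ`-polynomial: the largest order `e₁ + ⋯ + eₘ` of a `Δ`-operator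
`δ₁ ^ e₁ ⋯ δₘ ^ eₘ` that appears in it (and `0` for constants). -/
noncomputable def order {m n : ℕ} {k : Type*} [CommRing k] (f : DeltaPoly m n k) : ℕ :=
  f.vars.sup fun v => ∑ l, v.2 l

/-- `f` has degree and order at most `d`. -/
def Bounded {m n : ℕ} {k : Type*} [CommRing k] (d : ℕ) (f : DeltaPoly m n k) : Prop :=
  f.totalDegree ≤ d ∧ order f ≤ d

end DeltaPoly

/-- The definability-of-primality conjecture for `m` commuting derivations and `n` differential
indeterminates. -/
def DefinabilityOfPrimality.{u} (m n : ℕ) : Prop :=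
  ∀ d : ℕ, ∃ r : ℕ, ∀ (k : Type u) [Field k] [CharZero k] [DeltaRing m k]
    (S : Set (DeltaPoly m n k)), S.Finite → (∀ f ∈ S, f.Bounded d) →
      ((radicalDeltaIdeal m S).IsPrime ↔
        (radicalDeltaIdeal m S ≠ ⊤ ∧
          ∀ f g : DeltaPoly m n k, f.Bounded r → g.Bounded r →
            f * g ∈ radicalDeltaIdeal m S →
              f ∈ radicalDeltaIdeal m S ∨ g ∈ radicalDeltaIdeal m S))

/-! ### Ultraproducts of rings -/

/-- The ideal of all sequences that vanish almost everywhere. -/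
def ultraIdeal {ι : Type*} (U : Ultrafilter ι) (R : ι → Type*) [∀ r, CommRing (R r)] :
    Ideal (∀ r, R r) where
  carrier := {a | ∀ᶠ r in U, a r = 0}
  zero_mem' := Filter.Eventually.of_forall fun _ => rfl
  add_mem' {a b} ha hb := by
    filter_upwards [ha, hb] with r h1 h2
    simp [h1, h2]
  smul_mem' c a ha := by
    filter_upwards [ha] with r h
    simp [h]

/-- The ultraproduct `∏_U R_r`: sequences modulo equality almost everywhere. -/
abbrev Ultraproduct {ι : Type*} (U : Ultrafilter ι) (R : ι → Type*) [∀ r, CommRing (R r)] :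
    Type _ :=
  (∀ r, R r) ⧸ ultraIdeal U R

namespace Ultraproduct

variable {ι : Type*} (U : Ultrafilter ι) {R : ι → Type*} [∀ r, CommRing (R r)]

/-- The element of the ultraproduct with co-ordinates `a r`. -/
def mk : (∀ r, R r) →+* Ultraproduct U R := Ideal.Quotient.mk (ultraIdeal U R)

theorem mk_surjective : Function.Surjective (mk U (R := R)) := Ideal.Quotient.mk_surjective

theorem mk_eq_mk {a b : ∀ r, R r} : mk U a = mk U b ↔ ∀ᶠ r in U, a r = b r := by
  refine (Ideal.Quotient.eq (I := ultraIdeal U R)).trans ?_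
  change (∀ᶠ r in U, (a - b) r = 0) ↔ _
  simp only [Pi.sub_apply, sub_eq_zero]

/-- An ultraproduct of fields is a field. -/
instance isMaximal_ultraIdeal {ι : Type*} (U : Ultrafilter ι) (K : ι → Type*)
    [∀ r, Field (K r)] : (ultraIdeal U K).IsMaximal := by
  refine Ideal.isMaximal_iff.2 ⟨fun h => ?_, fun J a hJ ha haJ => ?_⟩
  · obtain ⟨r, hr⟩ := (show ∀ᶠ r in (U : Filter ι), (1 : ∀ r, K r) r = 0 from h).exists
    exact one_ne_zero hr
  · have h : ∀ᶠ r in (U : Filter ι), a r ≠ 0 := Ultrafilter.eventually_not.2 ha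
    have h1 : (1 - (fun r => (a r)⁻¹) * a : ∀ r, K r) ∈ J := hJ (by
      change ∀ᶠ r in (U : Filter ι), 1 - (a r)⁻¹ * a r = 0
      filter_upwards [h] with r hr
      rw [inv_mul_cancel₀ hr, sub_self])
    have h2 := J.add_mem h1 (J.mul_mem_left (fun r => (a r)⁻¹) haJ)
    rwa [sub_add_cancel] at h2

/-- A derivation on each factor induces, co-ordinatewise, a derivation on the ultraproduct. -/
def derivation (D : ∀ r, RingDerivation (R r)) :
    RingDerivation (Ultraproduct U R) :=
  Derivation.mk'
    (AddMonoidHom.toIntLinearMap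
      (QuotientAddGroup.map (ultraIdeal U R).toAddSubgroup (ultraIdeal U R).toAddSubgroup
        { toFun := fun a r => D r (a r)
          map_zero' := by ext r; simp
          map_add' := fun a b => by ext r; simp }
        (fun a ha => by
          have ha' : ∀ᶠ r in (U : Filter ι), a r = 0 := ha
          change ∀ᶠ r in (U : Filter ι), D r (a r) = 0
          filter_upwards [ha'] with r h
          rw [h, map_zero])))
    (fun x y => by
      obtain ⟨a, rfl⟩ := mk_surjective U x
      obtain ⟨b, rfl⟩ := mk_surjective U y
      change mk U (fun r => D r (a r * b r)) =
        mk U a * mk U (fun r => D r (b r)) + mk U b * mk U (fun r => D r (a r))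
      rw [← map_mul, ← map_mul, ← map_add]
      congr 1
      ext r
      simp)

/-- The co-ordinatewise `Δ`-ring structure of an ultraproduct of `Δ`-rings. -/
instance instDeltaRing {m : ℕ} [∀ r, DeltaRing m (R r)] : DeltaRing m (Ultraproduct U R) where
  der j := derivation U fun _ => DeltaRing.der j
  der_comm i j x := by
    obtain ⟨a, rfl⟩ := mk_surjective U x
    change mk U (fun r => DeltaRing.der i (DeltaRing.der j (a r))) =
      mk U (fun r => DeltaRing.der j (DeltaRing.der i (a r)))
    simp only [DeltaRing.der_comm i j]

/-- The internal set with family of components `T`: an element belongs to it if and only if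
almost all its co-ordinates belong to the corresponding components. -/
def internalSet (T : ∀ r, Set (R r)) : Set (Ultraproduct U R) :=
  {x | ∃ a, mk U a = x ∧ ∀ᶠ r in U, a r ∈ T r}

theorem mk_mem_internalSet (T : ∀ r, Set (R r)) (a : ∀ r, R r) :
    mk U a ∈ internalSet U T ↔ ∀ᶠ r in U, a r ∈ T r := by
  constructor
  · rintro ⟨b, hb, h⟩
    filter_upwards [(mk_eq_mk U).1 hb, h] with r h1 h2
    rwa [← h1]
  · exact fun h => ⟨a, rfl, h⟩

/-- The internal ideal with family of components `I`. -/
def internalIdeal (I : ∀ r, Ideal (R r)) : Ideal (Ultraproduct U R) where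
  carrier := internalSet U fun r => (I r : Set (R r))
  zero_mem' := ⟨0, map_zero _, Filter.Eventually.of_forall fun r => (I r).zero_mem⟩
  add_mem' := by
    rintro _ _ ⟨a, rfl, ha⟩ ⟨b, rfl, hb⟩
    refine ⟨a + b, map_add _ _ _, ?_⟩
    filter_upwards [ha, hb] with r h1 h2
    exact (I r).add_mem h1 h2
  smul_mem' := by
    rintro c _ ⟨a, rfl, ha⟩
    obtain ⟨c, rfl⟩ := mk_surjective U c
    refine ⟨c * a, map_mul _ _ _, ?_⟩
    filter_upwards [ha] with r h
    exact (I r).mul_mem_left _ h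

/-- `{S}_int` for the internal set `S` with family of components `T`: the internal ideal whose
`r`th component is the radical `Δ`-ideal `{T r}`. -/
def internalRadicalDeltaIdeal (m : ℕ) [∀ r, DeltaRing m (R r)] (T : ∀ r, Set (R r)) :
    Ideal (Ultraproduct U R) :=
  internalIdeal U fun r => radicalDeltaIdeal m (T r)

end Ultraproduct

/-! ### Internal differential polynomials -/

/-- `K{X}_int`, the ring of internal `Δ`-polynomials over the ultraproduct of the `K r`. -/
abbrev InternalDeltaPoly {ι : Type*} (m n : ℕ) (U : Ultrafilter ι) (K : ι → Type*)
    [∀ r, CommRing (K r)] : Type _ :=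
  Ultraproduct U fun r => DeltaPoly m n (K r)

namespace InternalDeltaPoly

open MvPolynomial

/-- The inclusion of `K = ∏_U K_r` in `K{X}_int` as the constants, co-ordinatewise. -/
noncomputable def const {ι : Type*} (m n : ℕ) (U : Ultrafilter ι) (K : ι → Type*)
    [∀ r, CommRing (K r)] : Ultraproduct U K →+* InternalDeltaPoly m n U K :=
  Ideal.Quotient.lift (ultraIdeal U K)
    ((Ultraproduct.mk U).comp
      (RingHom.pi fun r => (C : K r →+* DeltaPoly m n (K r)).comp (Pi.evalRingHom K r)))
    (fun a ha => by
      have ha' : ∀ᶠ r in (U : Filter ι), a r = 0 := ha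
      rw [← map_zero (Ultraproduct.mk U)]
      refine (Ultraproduct.mk_eq_mk U).2 ?_
      filter_upwards [ha'] with r h
      change (C (a r) : DeltaPoly m n (K r)) = 0
      rw [h, map_zero])

/-- The natural embedding `K{X} → K{X}_int`, `∑ aᵢ Mᵢ ↦ (∑ aᵢ(r) Mᵢ)_r`, where the `Mᵢ` are
monomials in the algebraic indeterminates: it is `const` on the coefficients, and maps each
algebraic indeterminate to itself. -/
noncomputable def embed {ι : Type*} (m n : ℕ) (U : Ultrafilter ι) (K : ι → Type*)
    [∀ r, CommRing (K r)] : DeltaPoly m n (Ultraproduct U K) →+* InternalDeltaPoly m n U K :=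
  eval₂Hom (const m n U K) fun v => Ultraproduct.mk U fun _ => X v

end InternalDeltaPoly

universe u

/-!
The bridge between the two statements is the description of `K{X}` inside `K{X}_int`: it consists
of the classes of the sequences whose degrees and orders are bounded uniformly, almost everywhere
(`InternalDeltaPoly.mk_mem_range_embed_iff`), since there are only finitely many monomials of given
degree and order. Moreover an internal ideal is prime if and only if almost all its components are
(`Ultraproduct.internalIdeal_isPrime_iff`).

If definability of primality holds and `S ⊆ K{X}` is internal, a diagonal argument
(`InternalDeltaPoly.exists_eventually_bounded`) bounds almost all components `T r` uniformly, by
`d` say. The components may be infinite, but polynomials bounded by `d` span a finite-dimensional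
space, so each `{T r}` is generated by a finite subset of `T r`
(`DeltaPoly.exists_finite_radicalDeltaIdeal_eq`). If almost all `{T r}` were not prime, there would
be witnesses of non-primality whose degree and order are bounded independently of `r`; their classes
lie in `K{X}` and contradict the primality of `{S}_int ∩ K{X}`.

Conversely, if the bound fails for some `d`, counterexamples `(K r, S r)` to each bound `r` have an
ultraproduct in which `{S}_int ∩ K{X}` is prime: two elements of `K{X}` have co-ordinates bounded
by some `N`, and the `r`th counterexample passes the test for them as soon as `r ≥ N`. By the
transfer statement `{S}_int` is prime, so almost all `{S r}` are prime, which is absurd.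
-/

/-! ### Polynomials of bounded degree and order -/

namespace DeltaPoly

open MvPolynomial

variable {m n : ℕ} {k : Type*} [CommRing k]

theorem bounded_iff {d : ℕ} {f : DeltaPoly m n k} :
    f.Bounded d ↔ f.totalDegree ≤ d ∧ ∀ v ∈ f.vars, ∑ l, v.2 l ≤ d := by
  rw [Bounded, order, Finset.sup_le_iff]

theorem Bounded.mono {d e : ℕ} (h : d ≤ e) {f : DeltaPoly m n k} (hf : f.Bounded d) :
    f.Bounded e :=
  ⟨hf.1.trans h, hf.2.trans h⟩

theorem bounded_C (a : k) : Bounded 0 (C a : DeltaPoly m n k) := by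
  simp [bounded_iff]

theorem bounded_X (v : Fin n × (Fin m → ℕ)) :
    Bounded (1 + ∑ l, v.2 l) (X v : DeltaPoly m n k) := by
  classical
  rw [bounded_iff]
  constructor
  · refine le_trans (totalDegree_monomial_le _ _) ?_
    simp
  · intro w hw
    have hv : w ∈ ({v} : Finset _) := by
      refine Finset.mem_of_subset ?_ hw
      intro w hw
      rw [mem_vars_iff_mem_support] at hw
      obtain ⟨e, he, hwe⟩ := hw
      have := support_monomial_subset he
      rw [Finset.mem_singleton] at this
      subst this
      exact Finsupp.support_single_subset hwe
    rw [Finset.mem_singleton.1 hv]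
    omega

theorem Bounded.add {d e : ℕ} {f g : DeltaPoly m n k} (hf : f.Bounded d) (hg : g.Bounded e) :
    (f + g).Bounded (d + e) := by
  classical
  have hf' := bounded_iff.1 (hf.mono (Nat.le_add_right d e))
  have hg' := bounded_iff.1 (hg.mono (Nat.le_add_left e d))
  refine bounded_iff.2 ⟨(totalDegree_add f g).trans (max_le hf'.1 hg'.1), fun v hv => ?_⟩
  exact (Finset.mem_union.1 (vars_add_subset f g hv)).elim (hf'.2 v) (hg'.2 v)

theorem Bounded.mul {d e : ℕ} {f g : DeltaPoly m n k} (hf : f.Bounded d) (hg : g.Bounded e) :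
    (f * g).Bounded (d + e) := by
  classical
  have hf' := bounded_iff.1 (hf.mono (Nat.le_add_right d e))
  have hg' := bounded_iff.1 (hg.mono (Nat.le_add_left e d))
  refine bounded_iff.2 ⟨(totalDegree_mul f g).trans (add_le_add hf.1 hg.1), fun v hv => ?_⟩
  exact (Finset.mem_union.1 (vars_mul f g hv)).elim (hf'.2 v) (hg'.2 v)

/-- A finite set of exponents containing those of all monomials of degree and order at most `d`:
every indeterminate involved is some `δ ^ e Xᵢ` with all `eₗ ≤ d`, and occurs with exponent at
most `d`. -/
noncomputable def boundedExponents (m n d : ℕ) : Finset (Fin n × (Fin m → ℕ) →₀ ℕ) :=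
  (Finset.univ ×ˢ Fintype.piFinset fun _ => Finset.range (d + 1)).finsupp
    fun _ => Finset.range (d + 1)

theorem Bounded.support_subset {d : ℕ} {f : DeltaPoly m n k} (hf : f.Bounded d) :
    f.support ⊆ boundedExponents m n d := by
  classical
  rw [bounded_iff] at hf
  intro e he
  rw [boundedExponents, Finset.mem_finsupp_iff]
  constructor
  · intro v hv
    have h := hf.2 v ((mem_vars_iff_mem_support v).2 ⟨e, he, hv⟩)
    simp only [Finset.mem_product, Finset.mem_univ, true_and, Fintype.mem_piFinset,
      Finset.mem_range, Nat.lt_succ_iff]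
    exact fun l =>
      (Finset.single_le_sum (f := v.2) (fun _ _ => Nat.zero_le _) (Finset.mem_univ l)).trans h
  · intro v _
    exact Finset.mem_range.2 (Nat.lt_succ_iff.2
      ((Finsupp.le_degree v e).trans ((le_totalDegree he).trans hf.1)))

theorem Bounded.eq_sum {d : ℕ} {f : DeltaPoly m n k} (hf : f.Bounded d) :
    f = ∑ e ∈ boundedExponents m n d, monomial e (coeff e f) := by
  conv_lhs => rw [f.as_sum]
  refine Finset.sum_subset hf.support_subset fun e _ he => ?_
  rw [notMem_support_iff.1 he, map_zero]

/-! ### Finite generation of bounded radical `Δ`-ideals -/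

/-- The polynomials bounded by `d` span a finite-dimensional space, so finitely many elements of
`T` span all of `T` linearly. -/
theorem exists_finite_radicalDeltaIdeal_eq {k : Type*} [Field k] [DeltaRing m k] {d : ℕ}
    {T : Set (DeltaPoly m n k)} (hT : ∀ f ∈ T, f.Bounded d) :
    ∃ F ⊆ T, F.Finite ∧ radicalDeltaIdeal m F = radicalDeltaIdeal m T := by
  classical
  let W : Submodule k (DeltaPoly m n k) :=
    Submodule.span k ((boundedExponents m n d).image fun e => monomial e (1 : k))
  have hTW : Submodule.span k T ≤ W := by
    refine Submodule.span_le.2 fun f hf => ?_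
    rw [SetLike.mem_coe, (hT f hf).eq_sum]
    refine Submodule.sum_mem _ fun e he => ?_
    rw [← mul_one (coeff e f), ← smul_eq_mul, ← smul_monomial]
    exact W.smul_mem _ (Submodule.subset_span (Finset.mem_coe.2 (Finset.mem_image_of_mem _ he)))
  have : FiniteDimensional k W := FiniteDimensional.span_finset k _
  have hfg : (Submodule.span k T).FG :=
    (Submodule.fg_iff_finiteDimensional _).2 (Submodule.finiteDimensional_of_le hTW)
  obtain ⟨F, hFT, hF⟩ := (Submodule.fg_span_iff_fg_span_finset_subset T).1 hfg
  refine ⟨F, hFT, F.finite_toSet, ?_⟩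
  unfold radicalDeltaIdeal
  congr 1
  ext I
  refine and_congr_left fun _ => ⟨fun h f hf => ?_, fun h => hFT.trans h⟩
  have h2 : Submodule.span k (F : Set (DeltaPoly m n k)) ≤ I.restrictScalars k :=
    Submodule.span_le.2 h
  exact h2 (hF ▸ Submodule.subset_span hf)

end DeltaPoly

/-! ### Primality of internal ideals -/

namespace Ultraproduct

variable {ι : Type*} (U : Ultrafilter ι) {R : ι → Type*} [∀ r, CommRing (R r)]

theorem mk_mem_internalIdeal (I : ∀ r, Ideal (R r)) (a : ∀ r, R r) :
    mk U a ∈ internalIdeal U I ↔ ∀ᶠ r in U, a r ∈ I r :=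
  mk_mem_internalSet U (fun r => (I r : Set (R r))) a

theorem internalIdeal_ne_top_iff (I : ∀ r, Ideal (R r)) :
    internalIdeal U I ≠ ⊤ ↔ ∀ᶠ r in U, I r ≠ ⊤ := by
  rw [Ne, Ideal.eq_top_iff_one, ← map_one (mk U), mk_mem_internalIdeal,
    ← Ultrafilter.eventually_not]
  simp only [Pi.one_apply, Ne, Ideal.eq_top_iff_one]

theorem internalIdeal_isPrime_iff (I : ∀ r, Ideal (R r)) :
    (internalIdeal U I).IsPrime ↔ ∀ᶠ r in U, (I r).IsPrime := by
  constructor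
  · intro h
    have hne := (internalIdeal_ne_top_iff U I).1 h.ne_top
    by_contra hcon
    rw [← Ultrafilter.eventually_not] at hcon
    have hw : ∀ᶠ r in U, ∃ p : R r × R r, p.1 * p.2 ∈ I r ∧ p.1 ∉ I r ∧ p.2 ∉ I r := by
      filter_upwards [hne, hcon] with r h1 h2
      by_contra! h3
      exact h2 ⟨h1, fun {x y} hxy => or_iff_not_imp_left.2 (h3 (x, y) hxy)⟩
    choose! p hp using fun r (h : ∃ p : R r × R r, p.1 * p.2 ∈ I r ∧ p.1 ∉ I r ∧ p.2 ∉ I r) => h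
    have hmul : mk U (fun r => (p r).1) * mk U (fun r => (p r).2) ∈ internalIdeal U I := by
      rw [← map_mul, mk_mem_internalIdeal]
      exact hw.mono fun r hr => (hp r hr).1
    rcases h.mem_or_mem hmul with h1 | h1 <;> rw [mk_mem_internalIdeal] at h1
    · obtain ⟨r, hr, hr'⟩ := (hw.and h1).exists
      exact (hp r hr).2.1 hr'
    · obtain ⟨r, hr, hr'⟩ := (hw.and h1).exists
      exact (hp r hr).2.2 hr'
  · intro h
    refine ⟨(internalIdeal_ne_top_iff U I).2 (h.mono fun r hr => hr.ne_top), fun {x y} hxy => ?_⟩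
    obtain ⟨a, rfl⟩ := mk_surjective U x
    obtain ⟨b, rfl⟩ := mk_surjective U y
    rw [← map_mul, mk_mem_internalIdeal] at hxy
    rw [mk_mem_internalIdeal, mk_mem_internalIdeal, ← Ultrafilter.eventually_or]
    filter_upwards [h, hxy] with r h1 h2
    exact h1.mem_or_mem h2

end Ultraproduct

/-! ### The image of `K{X}` in `K{X}_int` -/

namespace InternalDeltaPoly

open MvPolynomial DeltaPoly

variable {ι : Type*} {m n : ℕ} {U : Ultrafilter ι} {K : ι → Type*} [∀ r, CommRing (K r)]

/-- Every element of `K{X}` is represented by a sequence uniformly bounded in degree and order. -/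
theorem exists_bounded_of_embed (p : DeltaPoly m n (Ultraproduct U K)) :
    ∃ (N : ℕ) (a : ∀ r, DeltaPoly m n (K r)),
      (∀ r, (a r).Bounded N) ∧ Ultraproduct.mk U a = embed m n U K p := by
  induction p using MvPolynomial.induction_on with
  | C c =>
    obtain ⟨c, rfl⟩ := Ultraproduct.mk_surjective U c
    refine ⟨0, fun r => C (c r), fun r => bounded_C (c r), ?_⟩
    rw [embed, coe_eval₂Hom, eval₂_C]
    rfl
  | add p q hp hq =>
    obtain ⟨N, a, ha, hp⟩ := hp
    obtain ⟨M, b, hb, hq⟩ := hq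
    exact ⟨N + M, a + b, fun r => (ha r).add (hb r), by rw [map_add, map_add, hp, hq]⟩
  | mul_X p v hp =>
    obtain ⟨N, a, ha, hp⟩ := hp
    refine ⟨N + (1 + ∑ l, v.2 l), a * fun _ => X v, fun r => (ha r).mul (bounded_X v), ?_⟩
    rw [map_mul, map_mul, hp]
    congr 1
    rw [embed, coe_eval₂Hom, eval₂_X]

theorem mk_monomial_mem_range_embed (e : Fin n × (Fin m → ℕ) →₀ ℕ) (c : ∀ r, K r) :
    Ultraproduct.mk U (fun r => (monomial e (c r) : DeltaPoly m n (K r))) ∈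
      (embed m n U K).range := by
  refine ⟨monomial e (Ultraproduct.mk U c), ?_⟩
  rw [embed, coe_eval₂Hom, eval₂_monomial]
  have h : (fun r => (monomial e (c r) : DeltaPoly m n (K r))) =
      (fun r => C (c r)) * e.prod fun v i => (fun r => (X v : DeltaPoly m n (K r))) ^ i := by
    funext r
    rw [monomial_eq, Pi.mul_apply, Finsupp.prod, Finsupp.prod, Finset.prod_apply]
    rfl
  rw [h, map_mul, Finsupp.prod, Finsupp.prod, map_prod]
  simp only [map_pow]
  rfl

/-- The elements of `K{X}` are the classes of the sequences that are almost everywhere uniformly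
bounded in degree and order. -/
theorem mk_mem_range_embed_iff (a : ∀ r, DeltaPoly m n (K r)) :
    Ultraproduct.mk U a ∈ Set.range (embed m n U K) ↔ ∃ N, ∀ᶠ r in U, (a r).Bounded N := by
  constructor
  · rintro ⟨p, hp⟩
    obtain ⟨N, b, hb, h⟩ := exists_bounded_of_embed p
    refine ⟨N, ?_⟩
    filter_upwards [(Ultraproduct.mk_eq_mk U).1 (h.trans hp)] with r hr
    exact hr ▸ hb r
  · rintro ⟨N, hN⟩
    have h : Ultraproduct.mk U a = ∑ e ∈ boundedExponents m n N,
        Ultraproduct.mk U fun r => monomial e (coeff e (a r)) := by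
      rw [← map_sum]
      refine (Ultraproduct.mk_eq_mk U).2 ?_
      filter_upwards [hN] with r hr
      rw [Finset.sum_apply]
      exact hr.eq_sum
    rw [h]
    exact Subring.sum_mem _ fun e _ => mk_monomial_mem_range_embed e _

/-- If an internal set lies in `K{X}`, its components are almost everywhere uniformly bounded in
degree and order. -/
theorem exists_eventually_bounded {U : Ultrafilter ℕ} (hU : (U : Filter ℕ) ≤ Filter.atTop)
    {K : ℕ → Type*} [∀ r, CommRing (K r)] {T : ∀ r, Set (DeltaPoly m n (K r))}
    (hT : Ultraproduct.internalSet U T ⊆ Set.range (embed m n U K)) :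
    ∃ d, ∀ᶠ r in U, ∀ f ∈ T r, f.Bounded d := by
  classical
  by_contra! hcon
  -- In co-ordinate `r`, take an element exceeding the largest bound `≤ r` that can be exceeded.
  let ν : ℕ → ℕ := fun r => Nat.findGreatest (fun d => ∃ f ∈ T r, ¬ f.Bounded d) r
  choose! a haT ha using fun r (h : ∃ f ∈ T r, ¬ f.Bounded (ν r)) => h
  have hν : ∀ d, ∀ᶠ r in U, d ≤ ν r ∧ ∃ f ∈ T r, ¬ f.Bounded (ν r) := fun d => by
    filter_upwards [hcon d, hU (Filter.eventually_ge_atTop d)] with r h1 h2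
    exact ⟨Nat.le_findGreatest h2 h1,
      Nat.findGreatest_spec (P := fun d => ∃ f ∈ T r, ¬ f.Bounded d) h2 h1⟩
  have hmem : Ultraproduct.mk U a ∈ Ultraproduct.internalSet U T :=
    (Ultraproduct.mk_mem_internalSet U T a).2 ((hν 0).mono fun r hr => haT r hr.2)
  obtain ⟨N, hN⟩ := (mk_mem_range_embed_iff a).1 (hT hmem)
  obtain ⟨r, hr, hr'⟩ := (hN.and (hν N)).exists
  exact ha r hr'.2 (hr.mono hr'.1)

end InternalDeltaPoly

/-! ### Definability of primality and transfer of primality -/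

open DeltaPoly InternalDeltaPoly Ultraproduct in
/-- If almost all `{T r}` failed to be prime, definability would provide witnesses bounded
independently of `r`, whose classes in `K{X}` contradict `hprime`. -/
theorem DefinabilityOfPrimality.isPrime_internal.{v} {m n : ℕ}
    (hdef : DefinabilityOfPrimality.{v} m n) {U : Ultrafilter ℕ}
    (hU : (U : Filter ℕ) ≤ Filter.atTop) {K : ℕ → Type v} [∀ r, Field (K r)]
    [∀ r, CharZero (K r)] [∀ r, DeltaRing m (K r)] {T : ∀ r, Set (DeltaPoly m n (K r))}
    (hT : internalSet U T ⊆ Set.range (embed m n U K))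
    (hprime : ((internalRadicalDeltaIdeal U m T).comap (embed m n U K)).IsPrime) :
    (internalRadicalDeltaIdeal U m T).IsPrime := by
  obtain ⟨d, hd⟩ := exists_eventually_bounded hU hT
  obtain ⟨N, hN⟩ := hdef d
  refine (internalIdeal_isPrime_iff U _).2 ?_
  have hne : ∀ᶠ r in U, radicalDeltaIdeal m (T r) ≠ ⊤ :=
    (internalIdeal_ne_top_iff U _).1 fun h =>
      hprime.ne_top ((congrArg (Ideal.comap _) h).trans Ideal.comap_top)
  by_contra hcon
  rw [← Ultrafilter.eventually_not] at hcon
  have hw : ∀ᶠ r in U, ∃ p : DeltaPoly m n (K r) × DeltaPoly m n (K r),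
      (p.1.Bounded N ∧ p.2.Bounded N) ∧ p.1 * p.2 ∈ radicalDeltaIdeal m (T r) ∧
        p.1 ∉ radicalDeltaIdeal m (T r) ∧ p.2 ∉ radicalDeltaIdeal m (T r) := by
    filter_upwards [hd, hne, hcon] with r h1 h2 h3
    by_contra! h4
    obtain ⟨F, hFT, hF, hFeq⟩ := exists_finite_radicalDeltaIdeal_eq h1
    have h5 := hN (K r) F hF fun f hf => h1 f (hFT hf)
    rw [hFeq] at h5
    exact h3 (h5.2 ⟨h2, fun f g hf hg hfg => or_iff_not_imp_left.2 (h4 (f, g) ⟨hf, hg⟩ hfg)⟩)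
  choose! p hpN hp hp1 hp2 using fun r (h : ∃ p : DeltaPoly m n (K r) × DeltaPoly m n (K r),
      (p.1.Bounded N ∧ p.2.Bounded N) ∧ p.1 * p.2 ∈ radicalDeltaIdeal m (T r) ∧
        p.1 ∉ radicalDeltaIdeal m (T r) ∧ p.2 ∉ radicalDeltaIdeal m (T r)) => h
  obtain ⟨f, hf⟩ := (mk_mem_range_embed_iff (U := U) fun r => (p r).1).2
    ⟨N, hw.mono fun r hr => (hpN r hr).1⟩
  obtain ⟨g, hg⟩ := (mk_mem_range_embed_iff (U := U) fun r => (p r).2).2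
    ⟨N, hw.mono fun r hr => (hpN r hr).2⟩
  have hfg : f * g ∈ (internalRadicalDeltaIdeal U m T).comap (embed m n U K) := by
    rw [Ideal.mem_comap, map_mul, hf, hg, ← map_mul]
    exact (mk_mem_internalIdeal U _ _).2 (hw.mono hp)
  rcases hprime.mem_or_mem hfg with h | h
  · rw [Ideal.mem_comap, hf] at h
    obtain ⟨r, hr, hr'⟩ := (hw.and ((mk_mem_internalIdeal U _ _).1 h)).exists
    exact hp1 r hr hr'
  · rw [Ideal.mem_comap, hg] at h
    obtain ⟨r, hr, hr'⟩ := (hw.and ((mk_mem_internalIdeal U _ _).1 h)).exists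
    exact hp2 r hr hr'

open DeltaPoly InternalDeltaPoly Ultraproduct in
/-- If the `r`th component satisfies the primality test for polynomials bounded by `r`, the trace
of the internal ideal on `K{X}` is prime. -/
theorem InternalDeltaPoly.isPrime_comap_embed {m n : ℕ} {U : Ultrafilter ℕ}
    (hU : (U : Filter ℕ) ≤ Filter.atTop) {K : ℕ → Type*} [∀ r, CommRing (K r)]
    {I : ∀ r, Ideal (DeltaPoly m n (K r))} (hne : ∀ r, I r ≠ ⊤)
    (hI : ∀ r, ∀ f g : DeltaPoly m n (K r), f.Bounded r → g.Bounded r → f * g ∈ I r →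
      f ∈ I r ∨ g ∈ I r) :
    ((internalIdeal U I).comap (embed m n U K)).IsPrime := by
  refine ⟨Ideal.comap_ne_top _ ((internalIdeal_ne_top_iff U I).2 (.of_forall hne)),
    fun {f g} hfg => ?_⟩
  obtain ⟨M, a, ha, hfa⟩ := exists_bounded_of_embed f
  obtain ⟨N, b, hb, hgb⟩ := exists_bounded_of_embed g
  rw [Ideal.mem_comap, map_mul, ← hfa, ← hgb, ← map_mul, mk_mem_internalIdeal] at hfg
  rw [Ideal.mem_comap, Ideal.mem_comap, ← hfa, ← hgb, mk_mem_internalIdeal, mk_mem_internalIdeal,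
    ← Ultrafilter.eventually_or]
  filter_upwards [hfg, hU (Filter.eventually_ge_atTop M), hU (Filter.eventually_ge_atTop N)]
    with r h hM hN
  exact hI r _ _ ((ha r).mono hM) ((hb r).mono hN) h

theorem proposition5p1 (m n : ℕ) (U : Ultrafilter ℕ) (hU : ∀ r : ℕ, U ≠ pure r) :
    DefinabilityOfPrimality.{u} m n ↔
      ∀ (K : ℕ → Type u) [∀ r, Field (K r)] [∀ r, CharZero (K r)] [∀ r, DeltaRing m (K r)]
        (S : Set (InternalDeltaPoly m n U K)) (T : ∀ r, Set (DeltaPoly m n (K r))),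
        S = Ultraproduct.internalSet U T →
        S ⊆ Set.range (InternalDeltaPoly.embed m n U K) →
        ((Ultraproduct.internalRadicalDeltaIdeal U m T).comap
          (InternalDeltaPoly.embed m n U K)).IsPrime →
        (Ultraproduct.internalRadicalDeltaIdeal U m T).IsPrime := by
  have hU' : (U : Filter ℕ) ≤ Filter.atTop := by
    rw [← Nat.cofinite_eq_atTop]
    exact U.le_cofinite_or_eq_pure.resolve_right fun ⟨r, hr⟩ => hU r hr
  constructor
  · rintro hdef K _ _ _ _ T rfl hT hprime
    exact hdef.isPrime_internal hU' hT hprime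
  · intro hA d
    by_contra! hcon
    -- Only the implication from the bounded test to primality can fail.
    have hcon' : ∀ r : ℕ, ∃ (k : Type u) (_ : Field k) (_ : CharZero k) (_ : DeltaRing m k)
        (S : Set (DeltaPoly m n k)), (∀ f ∈ S, f.Bounded d) ∧
          ¬ (radicalDeltaIdeal m S).IsPrime ∧ radicalDeltaIdeal m S ≠ ⊤ ∧
          ∀ f g : DeltaPoly m n k, f.Bounded r → g.Bounded r → f * g ∈ radicalDeltaIdeal m S →
            f ∈ radicalDeltaIdeal m S ∨ g ∈ radicalDeltaIdeal m S := by
      intro r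
      obtain ⟨k, i1, i2, i3, S, -, hS, h⟩ := hcon r
      refine ⟨k, i1, i2, i3, S, hS, ?_⟩
      rcases h with ⟨h1, h2⟩ | ⟨h1, h2⟩
      · obtain ⟨f, g, -, -, hfg, hf, hg⟩ := h2 h1.ne_top
        exact ((h1.mem_or_mem hfg).elim hf hg).elim
      · exact ⟨h1, h2⟩
    choose K i1 i2 i3 T hT hnot hne htest using hcon'
    have hprime := hA K _ T rfl
      (by
        rintro _ ⟨a, rfl, ha⟩
        exact (InternalDeltaPoly.mk_mem_range_embed_iff a).2 ⟨d, ha.mono fun r hr => hT r _ hr⟩)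
      (InternalDeltaPoly.isPrime_comap_embed hU' hne htest)
    obtain ⟨r, hr⟩ := ((Ultraproduct.internalIdeal_isPrime_iff U _).1 hprime).exists
    exact hnot r hr
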